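/- For integers $a\ge 2$, $b\ge 1$ let $\zeta(a,b)=\sum_{n=1}^{\infty}\sum_{m=1}^{n-1}\frac{1}{n^a m^b}$, let $\zeta(s)$ be the Riemann zeta function, and let $H_m=\sum_{j=1}^{m}\frac1j$. Then for every integer $n\ge 2$, $$\begin{aligned} &\sum_{k=1}^{n-1}\Biggl\{\Biggl[1-\frac{1}{\binom{2n+2}{2k}}\Biggr]\frac{n+1}{k(n+1-k)}\,\zeta(2k,2n+2-2k)\\ &\qquad+\frac{\zeta(2n+2)}{\zeta(2n)}\Biggl[\frac{2}{(2n+1)\binom{2n}{2k}}-\frac{(2k-n)^2+(n+1)(n+2)}{(n-k+1)(2n-2k+1)(k+1)(2k+1)}\Biggr]\zeta(2k,2n-2k)\Biggr\}\\ &=3\Bigl[H_{2n-1}-H_{n-1}-\frac{2n^2+n+1}{2n(2n+1)}\Bigr]\zeta(2n+2)-\frac{2n+3}{2n+1}\,\zeta(2n,2). \end{aligned}$$ -/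

import Mathlib

/-- The double zeta value `ζ(a, b) = ∑_{n ≥ 1} ∑_{m = 1}^{n - 1} 1 / (n ^ a * m ^ b)`, for integers
`a ≥ 2` and `b ≥ 1`. (The term with `n = 0` is an empty sum.) It is a real number, taken in `ℂ` so
that it can be combined with Mathlib's `riemannZeta`. -/
noncomputable def doubleZeta (a b : ℕ) : ℂ :=
  ∑' n : ℕ, ∑ m ∈ Finset.Ico 1 n, 1 / ((n : ℂ) ^ a * (m : ℂ) ^ b)

/-- The series defining `doubleZeta a b` converges for `a ≥ 2` and `b ≥ 1`. -/
theorem summable_doubleZeta {a b : ℕ} (ha : 2 ≤ a) (hb : 1 ≤ b) :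
    Summable fun n : ℕ => ∑ m ∈ Finset.Ico 1 n, 1 / ((n : ℂ) ^ a * (m : ℂ) ^ b) := by
  have hs : Summable fun n : ℕ => 3 * (1 / (n : ℝ) ^ (3 / 2 : ℝ)) :=
    (Real.summable_one_div_nat_rpow.2 (by norm_num)).mul_left 3
  refine Summable.of_norm_bounded hs fun n => ?_
  rcases Nat.eq_zero_or_pos n with rfl | hn
  · simp
  have hn1 : (1 : ℝ) ≤ n := by exact_mod_cast hn
  have hn0 : (0 : ℝ) < n := by linarith
  have h1 : ‖∑ m ∈ Finset.Ico 1 n, 1 / ((n : ℂ) ^ a * (m : ℂ) ^ b)‖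
      ≤ ∑ m ∈ Finset.Ico 1 n, 1 / (n : ℝ) ^ 2 * (m : ℝ)⁻¹ := by
    refine (norm_sum_le _ _).trans (Finset.sum_le_sum fun m hm => ?_)
    have hm1 : (1 : ℝ) ≤ m := by exact_mod_cast (Finset.mem_Ico.1 hm).1
    have e1 : (n : ℝ) ^ 2 ≤ (n : ℝ) ^ a := pow_le_pow_right₀ hn1 ha
    have e2 : (m : ℝ) ≤ (m : ℝ) ^ b := by
      simpa using pow_le_pow_right₀ hm1 hb
    rw [← one_div, one_div_mul_one_div]
    simp only [norm_div, norm_one, norm_mul, norm_pow, Complex.norm_natCast]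
    gcongr
  have h2 : ∑ m ∈ Finset.Ico 1 n, (m : ℝ)⁻¹ ≤ 1 + Real.log n := by
    refine le_trans ?_ (harmonic_le_one_add_log n)
    rw [harmonic_eq_sum_Icc]
    push_cast
    exact Finset.sum_le_sum_of_subset_of_nonneg Finset.Ico_subset_Icc_self
      fun i _ _ => by positivity
  have h3 : Real.log n ≤ (n : ℝ) ^ (1 / 2 : ℝ) / (1 / 2) :=
    Real.log_le_rpow_div hn0.le (by norm_num)
  have h4 : (1 : ℝ) ≤ (n : ℝ) ^ (1 / 2 : ℝ) := Real.one_le_rpow hn1 (by norm_num)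
  have h5 : (n : ℝ) ^ 2 = (n : ℝ) ^ (3 / 2 : ℝ) * (n : ℝ) ^ (1 / 2 : ℝ) := by
    rw [← Real.rpow_add hn0, ← Real.rpow_natCast]
    norm_num
  rw [← Finset.mul_sum] at h1
  refine h1.trans ?_
  have h6 : ∑ m ∈ Finset.Ico 1 n, (m : ℝ)⁻¹ ≤ 3 * (n : ℝ) ^ (1 / 2 : ℝ) := by linarith
  calc 1 / (n : ℝ) ^ 2 * ∑ m ∈ Finset.Ico 1 n, (m : ℝ)⁻¹
      ≤ 1 / (n : ℝ) ^ 2 * (3 * (n : ℝ) ^ (1 / 2 : ℝ)) := by gcongr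
    _ = 3 * (1 / (n : ℝ) ^ (3 / 2 : ℝ)) := by
        rw [h5]
        have : (0 : ℝ) < (n : ℝ) ^ (1 / 2 : ℝ) := by positivity
        have : (0 : ℝ) < (n : ℝ) ^ (3 / 2 : ℝ) := by positivity
        field_simp

open Finset

/-! Both weights are invariant under k ↦ m - k, with m = n + 1 for the first and m = n for the
second, so each double zeta value can be averaged with its mirror image. The stuffle product
replaces ζ(2k, 2l) + ζ(2l, 2k) by ζ(2k)ζ(2l) - ζ(2m), where l = m - k. Euler's formula makes
ζ(2k)ζ(2l) a multiple of C(2m, 2k) B₂ₖ B₂ₗ whose factor depends on m alone. Only rational sums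
remain (`sum_symm_mul_doubleZeta`).

The Bernoulli sum is Miki's identity for the first weight, and Matiyasevich's identity plus its
reflection for the second. Each is a multiple of B₂ₘ, hence of ζ(2m), and the ratio ζ(2n+2)/ζ(2n)
brings both to ζ(2n+2). The plain sums of the weights give harmonic numbers together with sums of
1/C(2n, j), over odd j for the first weight and even j for the second; these combine into an
alternating sum that telescopes.

The Bernoulli identities are values at x = 0 of expansions of ∑ Bⱼ(x)Bₙ₋ⱼ(x), without and with the
weight 1/(j(n-j)). In each case the two sides have equal differences p(x+1) - p(x), so they differ
by a 1-periodic polynomial, which is constant. Applying this one degree higher and differentiating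
removes the constant. -/

theorem derivative_eq_zero_of_eval_one_add {p : Polynomial ℚ}
    (h : ∀ x, p.eval (1 + x) = p.eval x) : p.derivative = 0 := by
  have hnat : ∀ n : ℕ, p.eval (n : ℚ) = p.eval 0 := by
    intro n
    induction n with
    | zero => simp
    | succ n ih => rw [← ih, ← h n]; push_cast; ring_nf
  have hp : p = Polynomial.C (p.eval 0) := by
    refine Polynomial.eq_of_infinite_eval_eq _ _
      ((Set.infinite_range_of_injective (Nat.cast_injective (R := ℚ))).mono ?_)
    rintro _ ⟨n, rfl⟩
    simp [hnat n]
  rw [hp, Polynomial.derivative_C]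

/-- The range may run past n, so that polynomials of different degrees share one index range and
double sums can be interchanged. -/
theorem eval_bernoulli_eq_sum {n N : ℕ} (h : n ≤ N) (x : ℚ) :
    (Polynomial.bernoulli n).eval x
      = ∑ i ∈ range (N + 1), bernoulli i * n.choose i * x ^ (n - i) := by
  rw [Polynomial.bernoulli, Polynomial.eval_finsetSum]
  simp only [Polynomial.eval_monomial]
  refine sum_subset (range_subset_range.2 (by omega)) fun i _ hi => ?_
  rw [Nat.choose_eq_zero_of_lt (by simpa using hi)]
  simp

theorem sum_choose_fixed (i N : ℕ) :
    ∑ j ∈ range (N + 1), (j.choose i : ℚ) = (N + 1).choose (i + 1) := by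
  induction N with
  | zero => cases i <;> simp [Nat.choose_eq_zero_of_lt]
  | succ N ih => rw [sum_range_succ, ih, Nat.choose_succ_succ' (N + 1)]; push_cast; ring

/-- The hockey-stick identity iterated: N - j counts the partial sums that contain the j-th term. -/
theorem sum_sub_mul_choose (i N : ℕ) :
    ∑ j ∈ range (N + 1), ((N : ℚ) - j) * j.choose i = (N + 1).choose (i + 2) := by
  induction N with
  | zero => simp [Nat.choose_eq_zero_of_lt]
  | succ N ih =>
    rw [sum_range_succ, Nat.choose_succ_succ' (N + 1) (i + 1)]
    push_cast
    rw [← ih, ← sum_choose_fixed, ← sum_add_distrib, sub_self, zero_mul, add_zero]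
    exact sum_congr rfl fun j _ => by ring

theorem sum_mul_sub (N : ℚ) (M : ℕ) :
    ∑ j ∈ range M, (j : ℚ) * (N - j) = N * M * (M - 1) / 2 - (M - 1) * M * (2 * M - 1) / 6 := by
  induction M with
  | zero => simp
  | succ M ih => rw [sum_range_succ, ih]; push_cast; ring

/-! ### The unweighted convolution of Bernoulli polynomials -/

/-- The convolution `∑ Bⱼ(x) Bₙ₋ⱼ(x)` of Bernoulli polynomials. -/
noncomputable def bernoulliConv (n : ℕ) : Polynomial ℚ :=
  ∑ j ∈ range (n + 1), Polynomial.bernoulli j * Polynomial.bernoulli (n - j)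

/-- The expansion of `bernoulliConv` in the basis of Bernoulli polynomials. -/
noncomputable def bernoulliConvExpansion (n : ℕ) : Polynomial ℚ :=
  Polynomial.C (2 / (n + 2) : ℚ) * ∑ i ∈ range (n + 1),
      Polynomial.C ((n + 2).choose (i + 2) * bernoulli i) * Polynomial.bernoulli (n - i)
    + Polynomial.C ((n : ℚ) * (n + 1) / 6) * Polynomial.bernoulli (n - 1)

/-- After a shift of index, the two halves of the product rule contribute j + 1 and n - j + 1 to the
same product, and these add up to n + 2. -/
theorem derivative_bernoulliConv (n : ℕ) :
    (bernoulliConv (n + 1)).derivative = Polynomial.C (n + 2 : ℚ) * bernoulliConv n := by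
  simp only [bernoulliConv, Polynomial.derivative_sum, Polynomial.derivative_mul,
    sum_add_distrib]
  rw [sum_range_succ' (fun j => Polynomial.derivative (Polynomial.bernoulli j) * _),
    sum_range_succ (fun j => _ * Polynomial.derivative (Polynomial.bernoulli (n + 1 - j)))]
  simp only [Polynomial.bernoulli_zero, Polynomial.derivative_one, zero_mul, add_zero,
    Nat.sub_self, mul_zero, Nat.add_sub_add_right]
  rw [mul_sum, ← sum_add_distrib]
  refine sum_congr rfl fun j hj => ?_
  obtain ⟨d, rfl⟩ := Nat.exists_eq_add_of_le (Nat.lt_succ_iff.1 (mem_range.1 hj))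
  rw [show j + d + 1 - j = d + 1 by omega, show j + d - j = d by omega,
    Polynomial.derivative_bernoulli_add_one, Polynomial.derivative_bernoulli_add_one]
  simp only [map_add, Polynomial.C_ofNat, Polynomial.C_eq_natCast]
  push_cast
  ring

theorem derivative_bernoulliConvExpansion (n : ℕ) :
    (bernoulliConvExpansion (n + 1)).derivative
      = Polynomial.C (n + 2 : ℚ) * bernoulliConvExpansion n := by
  simp only [bernoulliConvExpansion, Polynomial.derivative_add, Polynomial.derivative_C_mul,
    Polynomial.derivative_sum, mul_add, ← mul_assoc, ← Polynomial.C_mul]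
  refine congrArg₂ (· + ·) ?_ ?_
  · rw [sum_range_succ, mul_add, mul_sum, mul_sum]
    simp only [Nat.sub_self, Polynomial.bernoulli_zero, Polynomial.derivative_one, mul_zero,
      add_zero]
    refine sum_congr rfl fun j hj => ?_
    obtain ⟨d, rfl⟩ := Nat.exists_eq_add_of_le (Nat.lt_succ_iff.1 (mem_range.1 hj))
    rw [show j + d + 1 - j = d + 1 by omega, show j + d - j = d by omega,
      Polynomial.derivative_bernoulli_add_one]
    have h := Nat.choose_mul_succ_eq (j + d + 2) (j + 2)
    rw [show j + d + 2 + 1 - (j + 2) = d + 1 by omega] at h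
    have h' : ((j + d + 2).choose (j + 2) : ℚ) * (j + d + 3)
        = (j + d + 3).choose (j + 2) * (d + 1) := by exact_mod_cast h
    have e : (d + 1 : Polynomial ℚ) = Polynomial.C (d + 1 : ℚ) := by simp
    rw [e, ← mul_assoc, ← mul_assoc, ← mul_assoc, ← Polynomial.C_mul, ← Polynomial.C_mul,
      ← Polynomial.C_mul]
    refine congrArg (Polynomial.C · * Polynomial.bernoulli d) ?_
    rw [show j + d + 1 + 2 = j + d + 3 by ring]
    push_cast
    have : (j + d + 1 + 2 : ℚ) ≠ 0 := by positivity
    have : (j + d + 2 : ℚ) ≠ 0 := by positivity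
    field_simp
    linear_combination -bernoulli j * h'
  · rw [Nat.add_sub_cancel, Polynomial.derivative_bernoulli, ← Polynomial.C_eq_natCast,
      ← mul_assoc, ← Polynomial.C_mul]
    refine congrArg (Polynomial.C · * Polynomial.bernoulli (n - 1)) ?_
    push_cast
    ring

/-- Expand each Bⱼ(x) in powers of x and sum over j first. Truncated exponents do no harm: their
coefficients vanish. -/
theorem sum_pow_mul_eval_bernoulli (N : ℕ) (x : ℚ) :
    ∑ j ∈ range (N + 1), ((N : ℚ) - j) * x ^ (N - j - 1) * (Polynomial.bernoulli j).eval x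
      = ∑ i ∈ range (N + 1), bernoulli i * (N + 1).choose (i + 2) * x ^ (N - i - 1) := by
  have h1 : ∀ j ∈ range (N + 1),
      ((N : ℚ) - j) * x ^ (N - j - 1) * (Polynomial.bernoulli j).eval x
        = ∑ i ∈ range (N + 1),
          bernoulli i * (((N : ℚ) - j) * j.choose i) * x ^ (N - i - 1) := by
    intro j hj
    have hj' : j ≤ N := Nat.lt_succ_iff.1 (mem_range.1 hj)
    rw [eval_bernoulli_eq_sum hj', mul_sum]
    refine sum_congr rfl fun i _ => ?_
    rcases lt_or_ge j i with h | h
    · simp [Nat.choose_eq_zero_of_lt h]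
    rcases hj'.eq_or_lt with rfl | h'
    · simp
    rw [show N - i - 1 = (N - j - 1) + (j - i) by omega, pow_add]
    ring
  rw [sum_congr rfl h1, sum_comm]
  refine sum_congr rfl fun i _ => ?_
  rw [← sum_sub_mul_choose, mul_sum, sum_mul]

/-- Multiply out with Bⱼ(1+x) = Bⱼ(x) + j xʲ⁻¹. The two cross sums agree by reflection; the product
of the two increments gives ∑ j(N-j) times a power of x, the source of the extra Bₙ₋₁ term in the
expansion. -/
theorem eval_one_add_bernoulliConv (N : ℕ) (x : ℚ) :
    (bernoulliConv N).eval (1 + x) = (bernoulliConv N).eval x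
      + 2 * ∑ i ∈ range (N + 1), bernoulli i * (N + 1).choose (i + 2) * x ^ (N - i - 1)
      + (N - 1) * N * (N + 1) / 6 * x ^ (N - 2) := by
  have h2 : ∑ j ∈ range (N + 1),
      (j : ℚ) * x ^ (j - 1) * (Polynomial.bernoulli (N - j)).eval x
      = ∑ j ∈ range (N + 1),
        ((N : ℚ) - j) * x ^ (N - j - 1) * (Polynomial.bernoulli j).eval x := by
    rw [← sum_range_reflect]
    refine sum_congr rfl fun j hj => ?_
    have hj' : j ≤ N := Nat.lt_succ_iff.1 (mem_range.1 hj)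
    rw [show N + 1 - 1 - j = N - j by omega, show N - (N - j) = j by omega, Nat.cast_sub hj']
  have h3 : ∑ j ∈ range (N + 1), (j : ℚ) * x ^ (j - 1) * (((N : ℚ) - j) * x ^ (N - j - 1))
      = (N - 1) * N * (N + 1) / 6 * x ^ (N - 2) := by
    have e := sum_mul_sub N (N + 1)
    rw [show ((N : ℚ) - 1) * N * (N + 1) / 6 = ∑ j ∈ range (N + 1), (j : ℚ) * (N - j) by
      rw [e]; push_cast; ring, sum_mul]
    refine sum_congr rfl fun j hj => ?_
    have hj' : j ≤ N := Nat.lt_succ_iff.1 (mem_range.1 hj)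
    rcases Nat.eq_zero_or_pos j with rfl | h0
    · simp
    rcases hj'.eq_or_lt with rfl | h'
    · simp
    rw [show N - 2 = (j - 1) + (N - j - 1) by omega, pow_add]
    ring
  rw [← sum_pow_mul_eval_bernoulli, two_mul, ← h3]
  nth_rw 1 [← h2]
  simp only [bernoulliConv, Polynomial.eval_finsetSum, Polynomial.eval_mul,
    Polynomial.bernoulli_eval_one_add]
  rw [← sum_add_distrib, ← sum_add_distrib, ← sum_add_distrib]
  refine sum_congr rfl fun j hj => ?_
  rw [Nat.cast_sub (Nat.lt_succ_iff.1 (mem_range.1 hj))]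
  ring

theorem eval_one_add_bernoulliConvExpansion (N : ℕ) (x : ℚ) :
    (bernoulliConvExpansion N).eval (1 + x) = (bernoulliConvExpansion N).eval x
      + 2 * ∑ i ∈ range (N + 1), bernoulli i * (N + 1).choose (i + 2) * x ^ (N - i - 1)
      + (N - 1) * N * (N + 1) / 6 * x ^ (N - 2) := by
  simp only [bernoulliConvExpansion, Polynomial.eval_add, Polynomial.eval_finsetSum,
    Polynomial.eval_mul, Polynomial.eval_C, Polynomial.bernoulli_eval_one_add, mul_add,
    sum_add_distrib]
  have h1 : 2 / ((N : ℚ) + 2) * ∑ i ∈ range (N + 1),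
        (N + 2).choose (i + 2) * bernoulli i * ((N - i : ℕ) * x ^ (N - i - 1))
      = 2 * ∑ i ∈ range (N + 1), bernoulli i * (N + 1).choose (i + 2) * x ^ (N - i - 1) := by
    rw [mul_sum, mul_sum]
    refine sum_congr rfl fun i hi => ?_
    obtain ⟨d, rfl⟩ := Nat.exists_eq_add_of_le (Nat.lt_succ_iff.1 (mem_range.1 hi))
    have h := Nat.choose_mul_succ_eq (i + d + 1) (i + 2)
    rw [show i + d + 1 + 1 - (i + 2) = d by omega] at h
    have h' : ((i + d + 1).choose (i + 2) : ℚ) * (i + d + 2)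
        = (i + d + 2).choose (i + 2) * d := by exact_mod_cast h
    rw [show i + d - i = d by omega]
    push_cast
    have : (i + d + 2 : ℚ) ≠ 0 := by positivity
    field_simp
    linear_combination -bernoulli i * x ^ (d - 1) * h'
  have h2 : (N : ℚ) * (N + 1) / 6 * ((N - 1 : ℕ) * x ^ (N - 1 - 1))
      = (N - 1) * N * (N + 1) / 6 * x ^ (N - 2) := by
    rcases N with _ | N
    · simp
    · rw [show N + 1 - 1 - 1 = N + 1 - 2 by omega, Nat.add_sub_cancel]
      push_cast
      ring
  linear_combination h1 + h2

/-- The comparison is made at n + 1, where equal differences leave an unknown constant;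
differentiating kills it and returns n + 2 times the claim at n. -/
theorem bernoulliConv_eq_expansion (n : ℕ) : bernoulliConv n = bernoulliConvExpansion n := by
  have h := derivative_eq_zero_of_eval_one_add
    (p := bernoulliConv (n + 1) - bernoulliConvExpansion (n + 1)) fun x => by
      rw [Polynomial.eval_sub, Polynomial.eval_sub, eval_one_add_bernoulliConv,
        eval_one_add_bernoulliConvExpansion]
      ring
  rw [Polynomial.derivative_sub, derivative_bernoulliConv, derivative_bernoulliConvExpansion,
    ← mul_sub, mul_eq_zero] at h
  rcases h with h | h
  · rw [Polynomial.C_eq_zero] at h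
    exact absurd h (by positivity)
  · exact sub_eq_zero.1 h

/-! ### The convolution weighted by 1/(k(n-k)) -/

/-- The convolution `∑ Bₖ(x) Bₙ₋ₖ(x) / (k (n - k))` over `0 < k < n`, for `n = N + 2`. -/
noncomputable def bernoulliDivConv (N : ℕ) : Polynomial ℚ :=
  ∑ j ∈ range (N + 1), Polynomial.C (1 / (((j : ℚ) + 1) * (N + 1 - j)))
    * (Polynomial.bernoulli (j + 1) * Polynomial.bernoulli (N + 1 - j))

/-- The expansion of `bernoulliDivConv` in the basis of Bernoulli polynomials. -/
noncomputable def bernoulliDivConvExpansion (N : ℕ) : Polynomial ℚ :=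
  Polynomial.C (2 / (N + 2) : ℚ) * ∑ i ∈ range (N + 3),
      Polynomial.C ((N + 2).choose i * bernoulli i / i) * Polynomial.bernoulli (N + 2 - i)
    + Polynomial.C (2 / (N + 2) * harmonic (N + 1)) * Polynomial.bernoulli (N + 2)
    + Polynomial.bernoulli (N + 1)

/-- Differentiation cancels one denominator factor, leaving two sums equal by reflection. Their last
term gives Bₙ₊₂ (n = N); the others regroup through 1/(j+1) + 1/(N+1-j) = (N+2)/((j+1)(N+1-j)). -/
theorem derivative_bernoulliDivConv (N : ℕ) :
    (bernoulliDivConv (N + 1)).derivative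
      = Polynomial.C (2 / (N + 2) : ℚ) * Polynomial.bernoulli (N + 2)
        + Polynomial.C (N + 2 : ℚ) * bernoulliDivConv N := by
  let f : ℕ → Polynomial ℚ := fun j =>
    Polynomial.bernoulli (j + 1) * Polynomial.bernoulli (N + 1 - j)
  have hf : ∀ j ∈ range (N + 1), f (N + 1 - 1 - j) = f j := by
    intro j hj
    have hj' : j ≤ N := Nat.lt_succ_iff.1 (mem_range.1 hj)
    simp only [f]
    rw [show N + 1 - 1 - j + 1 = N + 1 - j by omega, show N + 1 - (N + 1 - 1 - j) = j + 1 by omega,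
      mul_comm]
  have h1 : (bernoulliDivConv (N + 1)).derivative
      = 2 * ∑ j ∈ range (N + 2), Polynomial.C (1 / ((j : ℚ) + 1)) * f j := by
    have e1 : (bernoulliDivConv (N + 1)).derivative
        = ∑ j ∈ range (N + 2), (Polynomial.C (1 / ((N : ℚ) + 2 - j))
            * (Polynomial.bernoulli j * Polynomial.bernoulli (N + 2 - j))
          + Polynomial.C (1 / ((j : ℚ) + 1)) * f j) := by
      rw [bernoulliDivConv, Polynomial.derivative_sum]
      refine sum_congr rfl fun j hj => ?_
      obtain ⟨d, hd⟩ := Nat.exists_eq_add_of_le (Nat.lt_succ_iff.1 (mem_range.1 hj))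
      have hd' : (N : ℚ) = j + d - 1 := by
        have : ((N + 1 : ℕ) : ℚ) = (j + d : ℕ) := by rw [hd]
        push_cast at this
        linarith
      simp only [f]
      rw [show N + 1 + 1 - j = d + 1 by omega,
        show N + 1 - j = d by omega, Polynomial.derivative_C_mul, Polynomial.derivative_mul,
        Polynomial.derivative_bernoulli_add_one, Polynomial.derivative_bernoulli_add_one]
      have e2 : Polynomial.C (1 / (((j : ℚ) + 1) * (((N + 1 : ℕ) : ℚ) + 1 - j)))
          * ((j : Polynomial ℚ) + 1) = Polynomial.C (1 / ((N : ℚ) + 2 - j)) := by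
        rw [show (j : Polynomial ℚ) + 1 = Polynomial.C ((j : ℚ) + 1) by simp, ← Polynomial.C_mul,
          hd']
        congr 1
        push_cast
        rw [hd', show (j + d - 1 + 1 + 1 - j : ℚ) = d + 1 by ring,
          show (j + d - 1 + 2 - j : ℚ) = d + 1 by ring]
        field_simp
      have e3 : Polynomial.C (1 / (((j : ℚ) + 1) * (((N + 1 : ℕ) : ℚ) + 1 - j)))
          * ((d : Polynomial ℚ) + 1) = Polynomial.C (1 / ((j : ℚ) + 1)) := by
        rw [show (d : Polynomial ℚ) + 1 = Polynomial.C ((d : ℚ) + 1) by simp, ← Polynomial.C_mul]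
        congr 1
        push_cast
        rw [hd', show (j + d - 1 + 1 + 1 - j : ℚ) = d + 1 by ring]
        field_simp
      rw [← e2, ← e3]
      ring
    rw [e1, sum_add_distrib, two_mul]
    refine congrArg₂ (· + ·) ?_ rfl
    rw [← sum_range_reflect]
    refine sum_congr rfl fun j hj => ?_
    have hj' : j ≤ N + 1 := Nat.lt_succ_iff.1 (mem_range.1 hj)
    simp only [f]
    rw [show N + 2 - 1 - j = N + 1 - j by omega, show N + 2 - (N + 1 - j) = j + 1 by omega,
      Nat.cast_sub hj', mul_comm (Polynomial.bernoulli (N + 1 - j))]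
    refine congrArg (Polynomial.C · * _) ?_
    push_cast
    ring_nf
  have h2 : 2 * ∑ j ∈ range (N + 1), Polynomial.C (1 / ((j : ℚ) + 1)) * f j
      = Polynomial.C (N + 2 : ℚ) * bernoulliDivConv N := by
    rw [two_mul]
    nth_rw 2 [← sum_range_reflect]
    rw [← sum_add_distrib, bernoulliDivConv, mul_sum]
    refine sum_congr rfl fun j hj => ?_
    obtain ⟨d, hd⟩ := Nat.exists_eq_add_of_le (Nat.lt_succ_iff.1 (mem_range.1 hj))
    rw [hf j hj, ← add_mul, ← Polynomial.C_add]
    change _ * f j = _ * (_ * f j)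
    generalize f j = y
    rw [← mul_assoc, ← Polynomial.C_mul]
    refine congrArg (Polynomial.C · * y) ?_
    rw [show N + 1 - 1 - j = d by omega, hd]
    push_cast
    rw [show (j + d + 1 - j : ℚ) = d + 1 by ring]
    field_simp
    ring
  rw [h1, sum_range_succ, mul_add, h2, add_comm]
  refine congrArg₂ (· + ·) ?_ rfl
  simp only [f, Nat.sub_self, Polynomial.bernoulli_zero, mul_one]
  rw [← mul_assoc, show (2 : Polynomial ℚ) = Polynomial.C 2 from rfl, ← Polynomial.C_mul]
  refine congrArg (Polynomial.C · * _) ?_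
  push_cast
  ring

theorem derivative_bernoulliDivConvExpansion (N : ℕ) :
    (bernoulliDivConvExpansion (N + 1)).derivative
      = Polynomial.C (2 / (N + 2) : ℚ) * Polynomial.bernoulli (N + 2)
        + Polynomial.C (N + 2 : ℚ) * bernoulliDivConvExpansion N := by
  have h1 : Polynomial.C (2 / ((N + 1 : ℕ) + 2) : ℚ) * ∑ i ∈ range (N + 1 + 3),
        Polynomial.C ((N + 1 + 2).choose i * bernoulli i / i)
          * (Polynomial.bernoulli (N + 1 + 2 - i)).derivative
      = Polynomial.C (N + 2 : ℚ) * (Polynomial.C (2 / (N + 2) : ℚ) * ∑ i ∈ range (N + 3),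
        Polynomial.C ((N + 2).choose i * bernoulli i / i)
          * Polynomial.bernoulli (N + 2 - i)) := by
    rw [sum_range_succ, ← mul_assoc, ← Polynomial.C_mul]
    simp only [Nat.sub_self, Polynomial.bernoulli_zero, Polynomial.derivative_one, mul_zero,
      add_zero]
    rw [mul_sum, mul_sum]
    refine sum_congr rfl fun i hi => ?_
    obtain ⟨d, hd⟩ := Nat.exists_eq_add_of_le (Nat.lt_succ_iff.1 (mem_range.1 hi))
    have h := Nat.choose_mul_succ_eq (N + 2) i
    rw [show N + 2 + 1 - i = d + 1 by omega] at h
    have h' : ((N + 2).choose i : ℚ) * (N + 3) = (N + 3).choose i * (d + 1) := by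
      exact_mod_cast h
    rw [show N + 1 + 2 - i = d + 1 by omega, show N + 2 - i = d by omega,
      Polynomial.derivative_bernoulli_add_one,
      show (d : Polynomial ℚ) + 1 = Polynomial.C ((d : ℚ) + 1) by simp,
      ← mul_assoc, ← mul_assoc, ← mul_assoc, ← Polynomial.C_mul, ← Polynomial.C_mul,
      ← Polynomial.C_mul]
    refine congrArg (Polynomial.C · * _) ?_
    rw [show N + 1 + 2 = N + 3 by ring]
    push_cast
    have : (N + 1 + 2 : ℚ) ≠ 0 := by positivity
    have : (N + 2 : ℚ) ≠ 0 := by positivity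
    rcases Nat.eq_zero_or_pos i with rfl | h0
    · simp
    field_simp
    linear_combination -bernoulli i * h'
  have h2 : Polynomial.C (2 / ((N + 1 : ℕ) + 2) * harmonic (N + 1 + 1))
        * (Polynomial.bernoulli (N + 1 + 2)).derivative
      = Polynomial.C (2 / (N + 2) : ℚ) * Polynomial.bernoulli (N + 2)
        + Polynomial.C (N + 2 : ℚ)
          * (Polynomial.C (2 / (N + 2) * harmonic (N + 1)) * Polynomial.bernoulli (N + 2)) := by
    rw [Polynomial.derivative_bernoulli, ← Polynomial.C_eq_natCast, ← mul_assoc, ← mul_assoc,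
      ← Polynomial.C_mul, ← Polynomial.C_mul, ← add_mul, ← Polynomial.C_add, harmonic_succ]
    refine congrArg (Polynomial.C · * Polynomial.bernoulli (N + 2)) ?_
    push_cast
    have : (N + 1 + 2 : ℚ) ≠ 0 := by positivity
    field_simp
    ring
  have h3 : (Polynomial.bernoulli (N + 1 + 1)).derivative
      = Polynomial.C (N + 2 : ℚ) * Polynomial.bernoulli (N + 1) := by
    rw [Polynomial.derivative_bernoulli_add_one]
    refine congrArg (· * Polynomial.bernoulli (N + 1)) ?_
    simp only [Nat.cast_add, Nat.cast_one, map_add, Polynomial.C_eq_natCast, Polynomial.C_ofNat]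
    ring
  simp only [bernoulliDivConvExpansion, Polynomial.derivative_add, Polynomial.derivative_C_mul,
    Polynomial.derivative_sum]
  rw [h1, h2, h3]
  ring

/-- For i = 0 the quotient by i is 0 by convention, and the true value is the harmonic number. This
is why the expansion carries a separate harmonic term. -/
theorem sum_choose_succ_div (N i : ℕ) :
    ∑ j ∈ range (N + 1), ((j + 1).choose i : ℚ) / (j + 1)
      = (N + 1).choose i / i + if i = 0 then harmonic (N + 1) else 0 := by
  rcases i with _ | i
  · simp [harmonic]
  · rw [if_neg (by omega), add_zero, ← sum_choose_fixed, sum_div]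
    refine sum_congr rfl fun j _ => ?_
    have h : ((j : ℚ) + 1) * j.choose i = (j + 1).choose (i + 1) * (i + 1) := by
      exact_mod_cast Nat.add_one_mul_choose_eq j i
    push_cast
    field_simp
    linear_combination -h

theorem sum_pow_mul_eval_bernoulli_div (N : ℕ) (x : ℚ) :
    ∑ j ∈ range (N + 1), x ^ (N - j) / ((j : ℚ) + 1) * (Polynomial.bernoulli (j + 1)).eval x
      = ∑ i ∈ range (N + 3), bernoulli i * ((N + 1).choose i / i) * x ^ (N + 1 - i)
        + harmonic (N + 1) * x ^ (N + 1) := by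
  have h1 : ∀ j ∈ range (N + 1),
      x ^ (N - j) / ((j : ℚ) + 1) * (Polynomial.bernoulli (j + 1)).eval x
        = ∑ i ∈ range (N + 3),
          bernoulli i * (((j + 1).choose i : ℚ) / (j + 1)) * x ^ (N + 1 - i) := by
    intro j hj
    have hj' : j ≤ N := Nat.lt_succ_iff.1 (mem_range.1 hj)
    rw [eval_bernoulli_eq_sum (show j + 1 ≤ N + 2 by omega), mul_sum]
    refine sum_congr rfl fun i _ => ?_
    rcases lt_or_ge (j + 1) i with h | h
    · simp [Nat.choose_eq_zero_of_lt h]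
    rw [show N + 1 - i = (N - j) + (j + 1 - i) by omega, pow_add]
    ring
  rw [sum_congr rfl h1, sum_comm]
  simp_rw [← sum_mul, ← mul_sum, sum_choose_succ_div, mul_add, add_mul, sum_add_distrib]
  simp

theorem eval_one_add_bernoulliDivConv (N : ℕ) (x : ℚ) :
    (bernoulliDivConv N).eval (1 + x) = (bernoulliDivConv N).eval x
      + 2 * (∑ i ∈ range (N + 3), bernoulli i * ((N + 1).choose i / i) * x ^ (N + 1 - i)
        + harmonic (N + 1) * x ^ (N + 1)) + (N + 1) * x ^ N := by
  have h2 : ∑ j ∈ range (N + 1),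
      x ^ j / ((N : ℚ) + 1 - j) * (Polynomial.bernoulli (N + 1 - j)).eval x
      = ∑ j ∈ range (N + 1),
        x ^ (N - j) / ((j : ℚ) + 1) * (Polynomial.bernoulli (j + 1)).eval x := by
    rw [← sum_range_reflect]
    refine sum_congr rfl fun j hj => ?_
    have hj' : j ≤ N := Nat.lt_succ_iff.1 (mem_range.1 hj)
    rw [show N + 1 - 1 - j = N - j by omega, show N + 1 - (N - j) = j + 1 by omega,
      Nat.cast_sub hj', show (N : ℚ) + 1 - (N - j) = j + 1 by ring]
  have h3 : ((N : ℚ) + 1) * x ^ N = ∑ j ∈ range (N + 1), x ^ j * x ^ (N - j) := by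
    rw [sum_congr rfl fun j hj => by
      rw [← pow_add, Nat.add_sub_cancel' (Nat.lt_succ_iff.1 (mem_range.1 hj))]]
    simp
  rw [← sum_pow_mul_eval_bernoulli_div, two_mul, h3]
  nth_rw 1 [← h2]
  simp only [bernoulliDivConv, Polynomial.eval_finsetSum, Polynomial.eval_mul, Polynomial.eval_C,
    Polynomial.bernoulli_eval_one_add]
  rw [← sum_add_distrib, ← sum_add_distrib, ← sum_add_distrib]
  refine sum_congr rfl fun j hj => ?_
  obtain ⟨d, rfl⟩ := Nat.exists_eq_add_of_le (Nat.lt_succ_iff.1 (mem_range.1 hj))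
  rw [show j + d + 1 - j = d + 1 by omega, show j + d - j = d by omega]
  push_cast
  rw [show (j + d + 1 - j : ℚ) = d + 1 by ring]
  field_simp
  ring

theorem eval_one_add_bernoulliDivConvExpansion (N : ℕ) (x : ℚ) :
    (bernoulliDivConvExpansion N).eval (1 + x) = (bernoulliDivConvExpansion N).eval x
      + 2 * (∑ i ∈ range (N + 3), bernoulli i * ((N + 1).choose i / i) * x ^ (N + 1 - i)
        + harmonic (N + 1) * x ^ (N + 1)) + (N + 1) * x ^ N := by
  simp only [bernoulliDivConvExpansion, Polynomial.eval_add, Polynomial.eval_finsetSum,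
    Polynomial.eval_mul, Polynomial.eval_C, Polynomial.bernoulli_eval_one_add, mul_add,
    sum_add_distrib]
  have h1 : 2 / ((N : ℚ) + 2) * ∑ i ∈ range (N + 3),
        (N + 2).choose i * bernoulli i / i * ((N + 2 - i : ℕ) * x ^ (N + 2 - i - 1))
      = 2 * ∑ i ∈ range (N + 3), bernoulli i * ((N + 1).choose i / i) * x ^ (N + 1 - i) := by
    rw [mul_sum, mul_sum]
    refine sum_congr rfl fun i hi => ?_
    have hi' : i ≤ N + 2 := Nat.lt_succ_iff.1 (mem_range.1 hi)
    have h' : ((N + 1).choose i : ℚ) * (N + 2) = (N + 2).choose i * (N + 2 - i : ℕ) := by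
      exact_mod_cast Nat.choose_mul_succ_eq (N + 1) i
    rw [show N + 2 - i - 1 = N + 1 - i by omega]
    rcases Nat.eq_zero_or_pos i with rfl | h0
    · simp
    field_simp
    linear_combination -bernoulli i * x ^ (N + 1 - i) * h'
  have h2 : 2 / ((N : ℚ) + 2) * harmonic (N + 1) * ((N + 2 : ℕ) * x ^ (N + 2 - 1))
      = 2 * (harmonic (N + 1) * x ^ (N + 1)) := by
    rw [show N + 2 - 1 = N + 1 by omega]
    push_cast
    field_simp
  rw [Nat.add_sub_cancel, show ((N + 1 : ℕ) : ℚ) = N + 1 by push_cast; ring]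
  linear_combination h1 + h2

/-- As in the unweighted case; the extra Bernoulli polynomial in the two derivatives is the same and
cancels. -/
theorem bernoulliDivConv_eq_expansion (N : ℕ) :
    bernoulliDivConv N = bernoulliDivConvExpansion N := by
  have h := derivative_eq_zero_of_eval_one_add
    (p := bernoulliDivConv (N + 1) - bernoulliDivConvExpansion (N + 1)) fun x => by
      rw [Polynomial.eval_sub, Polynomial.eval_sub, eval_one_add_bernoulliDivConv,
        eval_one_add_bernoulliDivConvExpansion]
      ring
  rw [Polynomial.derivative_sub, derivative_bernoulliDivConv, derivative_bernoulliDivConvExpansion,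
    add_sub_add_left_eq_sub, ← mul_sub, mul_eq_zero] at h
  rcases h with h | h
  · rw [Polynomial.C_eq_zero] at h
    exact absurd h (by positivity)
  · exact sub_eq_zero.1 h

/-! ### Values at 0: the identities of Matiyasevich and Miki -/

theorem sum_range_two_mul_add_one {M : Type*} [AddCommMonoid M] (f : ℕ → M) (m : ℕ) :
    ∑ j ∈ range (2 * m + 1), f j
      = ∑ k ∈ range (m + 1), f (2 * k) + ∑ k ∈ range m, f (2 * k + 1) := by
  induction m with
  | zero => simp
  | succ m ih =>
    rw [show 2 * (m + 1) + 1 = 2 * m + 1 + 1 + 1 by ring, sum_range_succ, sum_range_succ, ih,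
      sum_range_succ _ (m + 1), sum_range_succ (fun k => f (2 * k + 1)) m,
      show 2 * (m + 1) = 2 * m + 1 + 1 by ring]
    abel

theorem sum_range_succ_eq_sum_Icc {M : Type*} [AddCommMonoid M] (f : ℕ → M) {m : ℕ}
    (hm : 1 ≤ m) : ∑ k ∈ range (m + 1), f k = f 0 + ∑ k ∈ Icc 1 (m - 1), f k + f m := by
  obtain ⟨p, rfl⟩ := Nat.exists_eq_add_of_le' hm
  rw [sum_range_succ, range_eq_Ico, sum_eq_sum_Ico_succ_bot (by omega), Nat.add_sub_cancel]
  rfl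

theorem sum_Icc_reflect {M : Type*} [AddCommMonoid M] (f : ℕ → M) (m : ℕ) :
    ∑ k ∈ Icc 1 (m - 1), f (m - k) = ∑ k ∈ Icc 1 (m - 1), f k := by
  refine sum_nbij' (fun k => m - k) (fun k => m - k) ?_ ?_ ?_ ?_ ?_
  all_goals intro k hk; simp only [mem_Icc] at *
  · omega
  · omega
  · omega
  · omega

/-- B₁ is nonzero, but its partner has odd index 2m - 1 ≥ 3. -/
theorem bernoulli_mul_bernoulli_eq_zero {m k : ℕ} (hm : 2 ≤ m) (hk : k < m) :
    bernoulli (2 * k + 1) * bernoulli (2 * m - (2 * k + 1)) = 0 := by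
  rcases Nat.eq_zero_or_pos k with rfl | h0
  · rw [bernoulli_eq_zero_of_odd (n := 2 * m - _) ⟨m - 1, by omega⟩ (by omega), mul_zero]
  · rw [bernoulli_eq_zero_of_odd (n := 2 * k + 1) ⟨k, rfl⟩ (by omega), zero_mul]

theorem sum_mul_bernoulli_mul_bernoulli (g : ℕ → ℚ) {m : ℕ} (hm : 2 ≤ m) :
    ∑ j ∈ range (2 * m + 1), g j * (bernoulli j * bernoulli (2 * m - j))
      = (g 0 + g (2 * m)) * bernoulli (2 * m)
        + ∑ k ∈ Icc 1 (m - 1),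
          g (2 * k) * (bernoulli (2 * k) * bernoulli (2 * m - 2 * k)) := by
  rw [sum_range_two_mul_add_one, sum_range_succ_eq_sum_Icc _ (by omega),
    sum_eq_zero (s := range m) fun k hk => by
      rw [bernoulli_mul_bernoulli_eq_zero hm (mem_range.1 hk), mul_zero]]
  simp only [mul_zero, Nat.sub_zero, Nat.sub_self, bernoulli_zero]
  ring

/-- Matiyasevich's identity. -/
theorem sum_one_sub_choose_mul_bernoulli {n : ℕ} (hn : 2 ≤ n) :
    ∑ k ∈ Icc 1 (n - 1), (1 - ((2 * n + 2).choose (2 * k + 2) : ℚ) / (n + 1))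
        * (bernoulli (2 * k) * bernoulli (2 * n - 2 * k))
      = n * (2 * n + 1) / (n + 1) * bernoulli (2 * n) := by
  have h := congrArg (Polynomial.eval 0) (bernoulliConv_eq_expansion (2 * n))
  simp only [bernoulliConv, bernoulliConvExpansion, Polynomial.eval_add,
    Polynomial.eval_finsetSum, Polynomial.eval_mul, Polynomial.eval_C,
    Polynomial.bernoulli_eval_zero] at h
  rw [bernoulli_eq_zero_of_odd (n := 2 * n - 1) ⟨n - 1, by omega⟩ (by omega), mul_zero, add_zero,
    mul_sum, ← sub_eq_zero, ← sum_sub_distrib] at h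
  have h' := sum_mul_bernoulli_mul_bernoulli
    (fun j => 1 - ((2 * n + 2).choose (j + 2) : ℚ) / (n + 1)) hn
  have hn0 : (n + 1 : ℚ) ≠ 0 := by positivity
  rw [show ∑ j ∈ range (2 * n + 1), (1 - ((2 * n + 2).choose (j + 2) : ℚ) / (n + 1))
      * (bernoulli j * bernoulli (2 * n - j)) = 0 by
    rw [← h]
    refine sum_congr rfl fun j _ => ?_
    push_cast
    have : (2 * n + 2 : ℚ) ≠ 0 := by positivity
    field_simp] at h'
  have e : ((2 * n + 2).choose (0 + 2) : ℚ) = (n + 1) * (2 * n + 1) := by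
    rw [zero_add, Nat.cast_choose_two]
    push_cast
    ring
  rw [e, Nat.choose_self] at h'
  rw [eq_neg_of_add_eq_zero_right h'.symm]
  push_cast
  field_simp
  ring

/-- Miki's identity, before symmetrization. -/
theorem sum_sub_choose_div_mul_bernoulli {m : ℕ} (hm : 2 ≤ m) :
    ∑ k ∈ Icc 1 (m - 1), ((m : ℚ) / (k * (m - k)) - 2 * (2 * m).choose (2 * k) / k)
        * (bernoulli (2 * k) * bernoulli (2 * m - 2 * k))
      = (2 / m + 4 * harmonic (2 * m - 1)) * bernoulli (2 * m) := by
  obtain ⟨N, hN⟩ : ∃ N, 2 * m = N + 2 := ⟨2 * m - 2, by omega⟩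
  have hN' : (N : ℚ) = 2 * m - 2 := by
    have : ((2 * m : ℕ) : ℚ) = (N + 2 : ℕ) := by rw [hN]
    push_cast at this
    linarith
  have h := congrArg (Polynomial.eval 0) (bernoulliDivConv_eq_expansion N)
  simp only [bernoulliDivConv, bernoulliDivConvExpansion, Polynomial.eval_add,
    Polynomial.eval_finsetSum, Polynomial.eval_mul, Polynomial.eval_C,
    Polynomial.bernoulli_eval_zero] at h
  have h1 : ∑ j ∈ range (2 * m + 1), 1 / ((j : ℚ) * (2 * m - j))
        * (bernoulli j * bernoulli (2 * m - j))
      = ∑ j ∈ range (N + 1), 1 / (((j : ℚ) + 1) * (N + 1 - j))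
        * (bernoulli (j + 1) * bernoulli (N + 1 - j)) := by
    -- The end terms j = 0 and j = 2m vanish because division by zero gives 0.
    rw [hN, sum_range_succ, sum_range_succ']
    rw [← hN]
    simp only [Nat.cast_zero, zero_mul, div_zero, add_zero, Nat.cast_mul, Nat.cast_ofNat, sub_self,
      mul_zero]
    refine sum_congr rfl fun j _ => ?_
    rw [hN, show N + 2 - (j + 1) = N + 1 - j by omega, hN']
    push_cast
    ring_nf
  rw [← h1, bernoulli_eq_zero_of_odd (n := N + 1) ⟨m - 1, by omega⟩ (by omega), add_zero, ← hN,
    show N + 3 = 2 * m + 1 by omega, show N + 1 = 2 * m - 1 by omega, hN',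
    show (2 * m - 2 + 2 : ℚ) = 2 * m by ring, sum_mul_bernoulli_mul_bernoulli _ hm] at h
  have h2 : ∑ i ∈ range (2 * m + 1),
        ((2 * m).choose i : ℚ) * bernoulli i / i * bernoulli (2 * m - i)
      = ∑ i ∈ range (2 * m + 1),
        ((2 * m).choose i : ℚ) / i * (bernoulli i * bernoulli (2 * m - i)) :=
    sum_congr rfl fun i _ => by ring
  have hm0 : (m : ℚ) ≠ 0 := by positivity
  rw [h2, sum_mul_bernoulli_mul_bernoulli _ hm] at h
  simp only [Nat.cast_zero, zero_mul, div_zero, add_zero, Nat.cast_mul, Nat.cast_ofNat, sub_self,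
    mul_zero, zero_add, Nat.choose_self, Nat.cast_one] at h
  have h3 : ∑ k ∈ Icc 1 (m - 1), ((m : ℚ) / (k * (m - k)) - 2 * (2 * m).choose (2 * k) / k)
        * (bernoulli (2 * k) * bernoulli (2 * m - 2 * k))
      = 4 * m * ∑ k ∈ Icc 1 (m - 1), 1 / (2 * (k : ℚ) * (2 * m - 2 * k))
          * (bernoulli (2 * k) * bernoulli (2 * m - 2 * k))
        - 4 * ∑ k ∈ Icc 1 (m - 1), ((2 * m).choose (2 * k) : ℚ) / (2 * k)
          * (bernoulli (2 * k) * bernoulli (2 * m - 2 * k)) := by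
    rw [mul_sum, mul_sum, ← sum_sub_distrib]
    refine sum_congr rfl fun k hk => ?_
    obtain ⟨hk1, hk2⟩ := mem_Icc.1 hk
    have hk0 : (k : ℚ) ≠ 0 := by positivity
    have hkm : (m - k : ℚ) ≠ 0 := by
      rw [← Nat.cast_sub (by omega)]
      exact_mod_cast (by omega : m - k ≠ 0)
    rw [show (2 * m - 2 * k : ℚ) = 2 * (m - k) by ring]
    field_simp
    ring
  rw [h3, h]
  field_simp
  ring

/-- Miki's identity. -/
theorem sum_choose_sub_one_mul_bernoulli {m : ℕ} (hm : 2 ≤ m) :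
    ∑ k ∈ Icc 1 (m - 1), (((2 * m).choose (2 * k) : ℚ) - 1) * (m / (k * (m - k)))
        * (bernoulli (2 * k) * bernoulli (2 * m - 2 * k))
      = -(2 / m + 4 * harmonic (2 * m - 1)) * bernoulli (2 * m) := by
  rw [neg_mul, ← sum_sub_choose_div_mul_bernoulli hm, ← sum_neg_distrib]
  -- Average with the reflected sum: 1/k + 1/(m-k) = m/(k(m-k)) makes the binomial term symmetric.
  refine mul_left_cancel₀ (two_ne_zero (α := ℚ)) ?_
  rw [two_mul (∑ k ∈ _, -_)]
  nth_rw 2 [← sum_Icc_reflect]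
  rw [mul_sum, ← sum_add_distrib]
  refine sum_congr rfl fun k hk => ?_
  obtain ⟨hk1, hk2⟩ := mem_Icc.1 hk
  have hk0 : (k : ℚ) ≠ 0 := by positivity
  have hkm : (m - k : ℚ) ≠ 0 := by
    rw [← Nat.cast_sub (by omega)]
    exact_mod_cast (by omega : m - k ≠ 0)
  rw [Nat.mul_sub, Nat.choose_symm (by omega), Nat.sub_sub_self (by omega),
    Nat.cast_sub (by omega), sub_sub_cancel]
  field_simp
  ring

/-! ### Sums of reciprocals -/

theorem sum_alternating_one_div_choose {N M : ℕ} (h : M ≤ N + 1) :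
    ∑ j ∈ range M, (-1 : ℚ) ^ j / N.choose j
      = (N + 1) / (N + 2) * (1 - (-1) ^ M / (N + 1).choose M) := by
  induction M with
  | zero => simp
  | succ M ih =>
    rw [sum_range_succ, ih (by omega)]
    have hM : M ≤ N := by omega
    have c0 : (N.choose M : ℚ) ≠ 0 := by exact_mod_cast (Nat.choose_pos hM).ne'
    have c1 : ((N + 1).choose M : ℚ) ≠ 0 := by
      exact_mod_cast (Nat.choose_pos (by omega)).ne'
    have c2 : ((N + 1).choose (M + 1) : ℚ) ≠ 0 := by
      exact_mod_cast (Nat.choose_pos (by omega)).ne'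
    have e1 : (N.choose M : ℚ) * (N + 1) = (N + 1).choose M * (N + 1 - M) := by
      have := Nat.choose_mul_succ_eq N M
      rw [← Nat.cast_succ, ← Nat.cast_sub (by omega)]
      exact_mod_cast this
    have e2 : ((N : ℚ) + 1) * N.choose M = (N + 1).choose (M + 1) * (M + 1) := by
      exact_mod_cast Nat.add_one_mul_choose_eq N M
    have f1 : 1 / ((N + 1).choose M : ℚ) = (N + 1 - M) / ((N + 1) * N.choose M) := by
      rw [div_eq_div_iff c1 (by positivity)]
      linear_combination e1
    have f2 : 1 / ((N + 1).choose (M + 1) : ℚ) = (M + 1) / ((N + 1) * N.choose M) := by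
      rw [div_eq_div_iff c2 (by positivity)]
      linear_combination e2
    -- The sum telescopes since 1/C(N+1, M) + 1/C(N+1, M+1) = (N+2)/((N+1) C(N, M)).
    rw [div_eq_mul_one_div _ ((N + 1).choose M : ℚ), f1,
      div_eq_mul_one_div _ ((N + 1).choose (M + 1) : ℚ), f2]
    field_simp
    ring

theorem sum_one_div_choose_odd_sub_even {n : ℕ} (hn : 1 ≤ n) :
    ∑ k ∈ Icc 1 n, 1 / ((2 * n).choose (2 * k - 1) : ℚ)
      - ∑ k ∈ Icc 1 (n - 1), 1 / ((2 * n).choose (2 * k) : ℚ) = 1 / (n + 1) := by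
  have h := sum_alternating_one_div_choose (N := 2 * n) (M := 2 * n + 1) le_rfl
  rw [sum_range_two_mul_add_one, sum_range_succ_eq_sum_Icc _ hn] at h
  have e : ∑ k ∈ Icc 1 n, 1 / ((2 * n).choose (2 * k - 1) : ℚ)
      = ∑ k ∈ range n, 1 / ((2 * n).choose (2 * k + 1) : ℚ) := by
    rw [range_eq_Ico]
    exact (sum_Ico_add' (fun k => 1 / ((2 * n).choose (2 * k - 1) : ℚ)) 0 n 1).symm
  rw [e]
  simp only [pow_mul, pow_succ, pow_zero, mul_neg, mul_one, neg_neg, one_pow, neg_div,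
    sum_neg_distrib, mul_zero, Nat.choose_zero_right, Nat.choose_self, Nat.cast_one,
    div_one] at h
  push_cast at h
  have : (n + 1 : ℚ) ≠ 0 := by positivity
  have : (2 * n + 2 : ℚ) ≠ 0 := by positivity
  field_simp at h ⊢
  linear_combination -h / 2

theorem sum_one_div_consecutive (n : ℕ) :
    ∑ k ∈ range n, 1 / ((2 * (k : ℚ) + 1) * (2 * k + 2)) = harmonic (2 * n) - harmonic n := by
  induction n with
  | zero => simp
  | succ n ih =>
    rw [sum_range_succ, ih, show 2 * (n + 1) = 2 * n + 1 + 1 by ring, harmonic_succ, harmonic_succ,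
      harmonic_succ]
    push_cast
    field_simp
    ring

/-! ### From double zeta values to Bernoulli numbers -/

/-- The stuffle product of two zeta values. -/
theorem doubleZeta_add_doubleZeta {a b : ℕ} (ha : 2 ≤ a) (hb : 2 ≤ b) :
    doubleZeta a b + doubleZeta b a
      = riemannZeta a * riemannZeta b - riemannZeta ((a + b : ℕ) : ℂ) := by
  have hs : ∀ {c : ℕ}, 2 ≤ c → Filter.Tendsto
      (fun N => ∑ n ∈ range N, 1 / (n : ℂ) ^ c) Filter.atTop (nhds (riemannZeta c)) := by
    intro c hc
    rw [zeta_nat_eq_tsum_of_gt_one (by omega)]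
    refine (Summable.hasSum ?_).tendsto_sum_nat
    have := (Complex.summable_one_div_nat_cpow (p := (c : ℂ))).2 (by simp; omega)
    simpa using this
  have h1 := (summable_doubleZeta ha (by omega : 1 ≤ b)).hasSum.tendsto_sum_nat
  have h2 := (summable_doubleZeta hb (by omega : 1 ≤ a)).hasSum.tendsto_sum_nat
  have h3 := ((hs ha).mul (hs hb)).sub (hs (c := a + b) (by omega))
  -- The identity already holds for partial sums: the square of pairs of indices below N splits into
  -- two triangles and the diagonal.
  refine tendsto_nhds_unique ((h1.add h2).congr fun N => ?_) h3
  have h0 : ∀ {c : ℕ}, 2 ≤ c → ∀ N, ∑ m ∈ range N, 1 / (m : ℂ) ^ c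
      = ∑ m ∈ Ico 1 N, 1 / (m : ℂ) ^ c := by
    intro c hc N
    rcases N with _ | N
    · simp
    · rw [range_eq_Ico, sum_eq_sum_Ico_succ_bot (by omega)]
      simp [show c ≠ 0 by omega]
  have h4 : ∀ c d n : ℕ, ∑ m ∈ Ico 1 n, 1 / ((n : ℂ) ^ c * (m : ℂ) ^ d)
      = 1 / (n : ℂ) ^ c * ∑ m ∈ Ico 1 n, 1 / (m : ℂ) ^ d := by
    intro c d n
    rw [mul_sum]
    exact sum_congr rfl fun m _ => by rw [one_div_mul_one_div]
  simp only [h4, ← h0 ha, ← h0 hb]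
  induction N with
  | zero => simp
  | succ N ih =>
    simp only [sum_range_succ] at ih ⊢
    have : 1 / (N : ℂ) ^ (a + b) = 1 / (N : ℂ) ^ a * (1 / (N : ℂ) ^ b) := by
      rw [pow_add, one_div_mul_one_div]
    rw [this]
    linear_combination ih

/-- The factor by which `ζ(2k)` differs from the Bernoulli number `B₂ₖ`. -/
noncomputable def zetaFactor (k : ℕ) : ℂ :=
  (-1) ^ (k + 1) * (2 : ℂ) ^ (2 * k - 1) * (Real.pi : ℂ) ^ (2 * k) / (Nat.factorial (2 * k) : ℂ)

theorem riemannZeta_eq_zetaFactor_mul {k : ℕ} (hk : k ≠ 0) :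
    riemannZeta ((2 * k : ℕ) : ℂ) = zetaFactor k * (bernoulli (2 * k) : ℂ) := by
  push_cast
  rw [riemannZeta_two_mul_nat hk, zetaFactor]
  ring

/-- The signs differ by -1, the powers of 2 by 1/2, and the factorials form the binomial
coefficient. -/
theorem zetaFactor_mul {k l : ℕ} (hk : 1 ≤ k) (hl : 1 ≤ l) :
    zetaFactor k * zetaFactor l
      = -(1 / 2) * (((2 * (k + l)).choose (2 * k) : ℚ) : ℂ) * zetaFactor (k + l) := by
  have h := Nat.choose_mul_factorial_mul_factorial (show 2 * k ≤ 2 * (k + l) by omega)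
  rw [show 2 * (k + l) - 2 * k = 2 * l by omega] at h
  have h' : ((2 * (k + l)).choose (2 * k) : ℂ) * (Nat.factorial (2 * k) : ℂ)
      * (Nat.factorial (2 * l) : ℂ) = (Nat.factorial (2 * (k + l)) : ℂ) := by exact_mod_cast h
  have f1 : (Nat.factorial (2 * k) : ℂ) ≠ 0 := by exact_mod_cast Nat.factorial_ne_zero _
  have f2 : (Nat.factorial (2 * l) : ℂ) ≠ 0 := by exact_mod_cast Nat.factorial_ne_zero _
  have f3 : ((2 * (k + l)).choose (2 * k) : ℂ) ≠ 0 := by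
    exact_mod_cast (Nat.choose_pos (by omega)).ne'
  simp only [zetaFactor]
  rw [← h', show 2 * (k + l) - 1 = (2 * k - 1) + (2 * l - 1) + 1 by omega]
  push_cast
  field_simp
  ring

theorem sum_symm_mul_doubleZeta {m : ℕ} (w : ℕ → ℚ)
    (hw : ∀ k ∈ Icc 1 (m - 1), w (m - k) = w k) :
    ∑ k ∈ Icc 1 (m - 1), (w k : ℂ) * doubleZeta (2 * k) (2 * m - 2 * k)
      = -(1 / 4) * zetaFactor m
          * ((∑ k ∈ Icc 1 (m - 1), w k * (2 * m).choose (2 * k)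
            * (bernoulli (2 * k) * bernoulli (2 * m - 2 * k)) : ℚ) : ℂ)
        - 1 / 2 * ((∑ k ∈ Icc 1 (m - 1), w k : ℚ) : ℂ) * riemannZeta ((2 * m : ℕ) : ℂ) := by
  refine mul_left_cancel₀ (two_ne_zero (α := ℂ)) ?_
  rw [two_mul]
  nth_rw 2 [← sum_Icc_reflect]
  push_cast
  simp only [mul_sum, sum_mul, mul_sub]
  rw [← sum_add_distrib, ← sum_sub_distrib]
  refine sum_congr rfl fun k hk => ?_
  obtain ⟨hk1, hk2⟩ := mem_Icc.1 hk
  obtain ⟨l, rfl⟩ := Nat.exists_eq_add_of_le (show k ≤ m by omega)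
  have hl : 1 ≤ l := by omega
  have hz := doubleZeta_add_doubleZeta (a := 2 * k) (b := 2 * l) (by omega) (by omega)
  rw [riemannZeta_eq_zetaFactor_mul (by omega), riemannZeta_eq_zetaFactor_mul (by omega),
    ← mul_add] at hz
  have hf := zetaFactor_mul hk1 hl
  rw [hw k hk, show k + l - k = l by omega, show 2 * (k + l) - 2 * k = 2 * l by omega,
    show 2 * (k + l) - 2 * l = 2 * k by omega]
  push_cast at hz hf ⊢
  linear_combination (w k : ℂ) * hz + (w k : ℂ) * bernoulli (2 * k) * bernoulli (2 * l) * hf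

/-! ### The two weights -/

theorem sum_weight_top {n : ℕ} (hn : 1 ≤ n) :
    ∑ k ∈ Icc 1 n, (1 - 1 / ((2 * n + 2).choose (2 * k) : ℚ)) * ((n + 1) / (k * (n + 1 - k)))
      = 2 * harmonic n
        - 2 / (2 * n + 1) * ∑ k ∈ Icc 1 n, 1 / ((2 * n).choose (2 * k - 1) : ℚ) := by
  have h1 : ∑ k ∈ Icc 1 n, (1 / (k : ℚ) + 1 / ((n + 1 - k : ℕ) : ℚ)) = 2 * harmonic n := by
    have := sum_Icc_reflect (fun k => 1 / (k : ℚ)) (n + 1)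
    rw [Nat.add_sub_cancel] at this
    rw [sum_add_distrib, this, harmonic_eq_sum_Icc, two_mul]
    simp
  rw [← h1, mul_sum, ← sum_sub_distrib]
  refine sum_congr rfl fun k hk => ?_
  obtain ⟨hk1, hk2⟩ := mem_Icc.1 hk
  obtain ⟨l, rfl⟩ := Nat.exists_eq_add_of_le hk1
  obtain ⟨d, rfl⟩ := Nat.exists_eq_add_of_le hk2
  have e1 := Nat.add_one_mul_choose_eq (2 * (1 + l + d) + 1) (2 * l + 1)
  have e2 := Nat.choose_mul_succ_eq (2 * (1 + l + d)) (2 * l + 1)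
  rw [show 2 * (1 + l + d) + 1 - (2 * l + 1) = 2 * d + 2 by omega] at e2
  rw [show 2 * (1 + l) - 1 = 2 * l + 1 by omega,
    show 2 * (1 + l + d) + 2 = 2 * (1 + l + d) + 1 + 1 by ring,
    show 2 * (1 + l) = 2 * l + 1 + 1 by ring, show 1 + l + d + 1 - (1 + l) = d + 1 by omega]
  have c1 : ((2 * (1 + l + d)).choose (2 * l + 1) : ℚ) ≠ 0 := by
    exact_mod_cast (Nat.choose_pos (by omega)).ne'
  have c2 : ((2 * (1 + l + d) + 1).choose (2 * l + 1) : ℚ) ≠ 0 := by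
    exact_mod_cast (Nat.choose_pos (by omega)).ne'
  have c3 : ((2 * (1 + l + d) + 1 + 1).choose (2 * l + 1 + 1) : ℚ) ≠ 0 := by
    exact_mod_cast (Nat.choose_pos (by omega)).ne'
  have e1' : (2 * (1 + l + d) + 2 : ℚ) * (2 * (1 + l + d) + 1).choose (2 * l + 1)
      = (2 * (1 + l + d) + 1 + 1).choose (2 * l + 1 + 1) * (2 * l + 2) := by exact_mod_cast e1
  have e2' : ((2 * (1 + l + d)).choose (2 * l + 1) : ℚ) * (2 * (1 + l + d) + 1)
      = (2 * (1 + l + d) + 1).choose (2 * l + 1) * (2 * d + 2) := by exact_mod_cast e2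
  -- This turns the reciprocal part of the weight into 2/((2n+1) C(2n, 2k-1)), the same shape as in
  -- the second weight.
  have e3 : 1 / ((2 * (1 + l + d) + 1 + 1).choose (2 * l + 1 + 1) : ℚ)
      = (2 * l + 2) * (2 * d + 2) / ((2 * (1 + l + d) + 2) * (2 * (1 + l + d) + 1)
        * (2 * (1 + l + d)).choose (2 * l + 1)) := by
    rw [div_eq_div_iff c3 (by positivity)]
    linear_combination (2 * (1 + l + d) + 2 : ℚ) * e2' + (2 * d + 2 : ℚ) * e1'
  rw [e3]
  push_cast
  rw [show (1 + l + d + 1 - (1 + l) : ℚ) = d + 1 by ring]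
  have : (1 + l + d + 1 : ℚ) ≠ 0 := by positivity
  field_simp
  ring

/-- The rational weight of `ζ(2k, 2n - 2k)` splits into two reciprocal binomial-type terms. -/
theorem weight_eq_add {n k : ℕ} (hk : k ≤ n) :
    ((2 * (k : ℚ) - n) ^ 2 + (n + 1) * (n + 2))
        / (((n : ℚ) - k + 1) * (2 * n - 2 * k + 1) * (k + 1) * (2 * k + 1))
      = 2 * (1 / ((2 * (k : ℚ) + 1) * (2 * k + 2))
        + 1 / ((2 * ((n - k : ℕ) : ℚ) + 1) * (2 * (n - k : ℕ) + 2))) := by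
  obtain ⟨d, rfl⟩ := Nat.exists_eq_add_of_le hk
  rw [show k + d - k = d by omega]
  push_cast
  rw [show (k + d - k + 1 : ℚ) = d + 1 by ring,
    show (2 * (k + d) - 2 * k + 1 : ℚ) = 2 * d + 1 by ring]
  field_simp
  ring

theorem sum_weight_bottom {n : ℕ} (hn : 1 ≤ n) :
    ∑ k ∈ Icc 1 (n - 1), (2 / ((2 * (n : ℚ) + 1) * (2 * n).choose (2 * k))
        - ((2 * (k : ℚ) - n) ^ 2 + (n + 1) * (n + 2))
          / (((n : ℚ) - k + 1) * (2 * n - 2 * k + 1) * (k + 1) * (2 * k + 1)))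
      = 2 / (2 * n + 1) * ∑ k ∈ Icc 1 (n - 1), 1 / ((2 * n).choose (2 * k) : ℚ)
        - 4 * (harmonic (2 * n) - harmonic n - 1 / 2) := by
  -- The 1/2 is the k = 0 term, absent from the sum.
  have h1 : harmonic (2 * n) - harmonic n - 1 / 2
      = ∑ k ∈ Icc 1 (n - 1), 1 / ((2 * (k : ℚ) + 1) * (2 * k + 2)) := by
    rw [← sum_one_div_consecutive, range_eq_Ico, sum_eq_sum_Ico_succ_bot (by omega)]
    obtain ⟨p, rfl⟩ := Nat.exists_eq_add_of_le' hn
    rw [Nat.add_sub_cancel, show Icc 1 p = Ico (0 + 1) (p + 1) from rfl]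
    push_cast
    ring
  rw [sum_sub_distrib]
  refine congrArg₂ (· - ·) ?_ ?_
  · rw [mul_sum]
    refine sum_congr rfl fun k hk => ?_
    rw [div_mul_div_comm, mul_one]
  · rw [sum_congr rfl fun k hk => weight_eq_add (by have := mem_Icc.1 hk; omega), ← mul_sum,
      sum_add_distrib,
      sum_Icc_reflect (fun k => 1 / ((2 * (k : ℚ) + 1) * (2 * k + 2))), h1]
    ring

/-- Times C(2n, 2k), the weight is 1/(2n+1) times the Matiyasevich coefficient plus its reflection,
because C(2n, 2k)/((2k+1)(2k+2)) = C(2n+2, 2k+2)/((2n+1)(2n+2)). -/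
theorem sum_weight_bottom_mul_bernoulli {n : ℕ} (hn : 2 ≤ n) :
    ∑ k ∈ Icc 1 (n - 1), (2 / ((2 * (n : ℚ) + 1) * (2 * n).choose (2 * k))
        - ((2 * (k : ℚ) - n) ^ 2 + (n + 1) * (n + 2))
          / (((n : ℚ) - k + 1) * (2 * n - 2 * k + 1) * (k + 1) * (2 * k + 1)))
        * (2 * n).choose (2 * k) * (bernoulli (2 * k) * bernoulli (2 * n - 2 * k))
      = 2 * n / (n + 1) * bernoulli (2 * n) := by
  have h := sum_one_sub_choose_mul_bernoulli hn
  have h' := h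
  rw [← sum_Icc_reflect] at h'
  have hn0 : (n + 1 : ℚ) ≠ 0 := by positivity
  have h1 : 2 * n / (n + 1) * bernoulli (2 * n)
      = 1 / (2 * n + 1) * (n * (2 * n + 1) / (n + 1) * bernoulli (2 * n)
        + n * (2 * n + 1) / (n + 1) * bernoulli (2 * n)) := by
    field_simp
    ring
  rw [h1]
  nth_rw 1 [← h]
  rw [← h', ← sum_add_distrib, mul_sum]
  refine sum_congr rfl fun k hk => ?_
  obtain ⟨hk1, hk2⟩ := mem_Icc.1 hk
  rw [weight_eq_add (by omega)]
  obtain ⟨d, rfl⟩ := Nat.exists_eq_add_of_le (show k ≤ n by omega)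
  have key : ∀ a b : ℕ, ((2 * (a + b) + 2).choose (2 * a + 2) : ℚ)
      = (2 * (a + b)).choose (2 * a) * ((2 * (a + b) + 1) * (2 * (a + b) + 2))
        / ((2 * a + 1) * (2 * a + 2)) := by
    intro a b
    have e1 := Nat.add_one_mul_choose_eq (2 * (a + b)) (2 * a)
    have e2 := Nat.add_one_mul_choose_eq (2 * (a + b) + 1) (2 * a + 1)
    have e1' : (2 * (a + b) + 1 : ℚ) * (2 * (a + b)).choose (2 * a)
        = (2 * (a + b) + 1).choose (2 * a + 1) * (2 * a + 1) := by exact_mod_cast e1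
    have e2' : (2 * (a + b) + 2 : ℚ) * (2 * (a + b) + 1).choose (2 * a + 1)
        = (2 * (a + b) + 2).choose (2 * a + 2) * (2 * a + 2) := by exact_mod_cast e2
    rw [eq_div_iff (by positivity)]
    linear_combination -(2 * a + 1 : ℚ) * e2' - (2 * (a + b) + 2 : ℚ) * e1'
  have k2 := key d k
  rw [add_comm d k, ← Nat.choose_symm (n := 2 * (k + d)) (k := 2 * d) (by omega),
    show 2 * (k + d) - 2 * d = 2 * k by omega] at k2
  rw [show k + d - k = d by omega, show 2 * (k + d) - 2 * k = 2 * d by omega,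
    show 2 * (k + d) - 2 * d = 2 * k by omega, key k d, k2]
  have c : ((2 * (k + d)).choose (2 * k) : ℚ) ≠ 0 := by
    exact_mod_cast (Nat.choose_pos (by omega)).ne'
  push_cast
  have : (k + d + 1 : ℚ) ≠ 0 := by positivity
  field_simp
  ring

/-! ### Assembly -/

theorem mainTheorem10 (n : ℕ) (hn : 2 ≤ n) :
    ∑ k ∈ Finset.Icc 1 (n - 1),
      ((1 - 1 / ((2 * n + 2).choose (2 * k) : ℂ)) * (((n : ℂ) + 1) / ((k : ℂ) * (n + 1 - k)))
          * doubleZeta (2 * k) (2 * n + 2 - 2 * k)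
        + riemannZeta (2 * n + 2) / riemannZeta (2 * n)
          * (2 / ((2 * (n : ℂ) + 1) * ((2 * n).choose (2 * k) : ℂ))
            - ((2 * (k : ℂ) - n) ^ 2 + (n + 1) * (n + 2))
              / (((n : ℂ) - k + 1) * (2 * n - 2 * k + 1) * (k + 1) * (2 * k + 1)))
          * doubleZeta (2 * k) (2 * n - 2 * k))
    = 3 * ((harmonic (2 * n - 1) : ℂ) - (harmonic (n - 1) : ℂ)
          - (2 * (n : ℂ) ^ 2 + n + 1) / (2 * n * (2 * n + 1))) * riemannZeta (2 * n + 2)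
      - (2 * (n : ℂ) + 3) / (2 * n + 1) * doubleZeta (2 * n) 2 := by
  let w : ℕ → ℚ := fun k =>
    (1 - 1 / ((2 * n + 2).choose (2 * k) : ℚ)) * ((n + 1) / (k * (n + 1 - k)))
  let v : ℕ → ℚ := fun k => 2 / ((2 * (n : ℚ) + 1) * (2 * n).choose (2 * k))
    - ((2 * (k : ℚ) - n) ^ 2 + (n + 1) * (n + 2))
      / (((n : ℚ) - k + 1) * (2 * n - 2 * k + 1) * (k + 1) * (2 * k + 1))
  have hw := sum_symm_mul_doubleZeta (m := n + 1) w fun k hk => by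
    obtain ⟨hk1, hk2⟩ := mem_Icc.1 hk
    simp only [w]
    rw [show 2 * (n + 1 - k) = 2 * n + 2 - 2 * k by omega, Nat.choose_symm (by omega),
      Nat.cast_sub (by omega)]
    push_cast
    rw [sub_sub_cancel, mul_comm (k : ℚ)]
  have hv := sum_symm_mul_doubleZeta (m := n) v fun k hk => by
    obtain ⟨hk1, hk2⟩ := mem_Icc.1 hk
    simp only [v]
    rw [Nat.mul_sub, Nat.choose_symm (by omega), Nat.cast_sub (by omega)]
    ring
  rw [Nat.add_sub_cancel] at hw
  have hwB : ∑ k ∈ Icc 1 n, w k * (2 * (n + 1)).choose (2 * k)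
        * (bernoulli (2 * k) * bernoulli (2 * (n + 1) - 2 * k))
      = -(2 / (n + 1) + 4 * harmonic (2 * n + 1)) * bernoulli (2 * (n + 1)) := by
    have h := sum_choose_sub_one_mul_bernoulli (m := n + 1) (by omega)
    rw [Nat.add_sub_cancel, show 2 * (n + 1) - 1 = 2 * n + 1 by omega] at h
    push_cast at h
    rw [← h]
    refine sum_congr rfl fun k hk => ?_
    obtain ⟨hk1, hk2⟩ := mem_Icc.1 hk
    have c : ((2 * (n + 1)).choose (2 * k) : ℚ) ≠ 0 := by
      exact_mod_cast (Nat.choose_pos (by omega)).ne'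
    simp only [w]
    rw [show 2 * n + 2 = 2 * (n + 1) by ring, sub_mul _ _ ((n + 1 : ℚ) / _), sub_mul, sub_mul,
      one_mul, sub_mul, sub_mul]
    field_simp
  have hvB : ∑ k ∈ Icc 1 (n - 1), v k * (2 * n).choose (2 * k)
        * (bernoulli (2 * k) * bernoulli (2 * n - 2 * k)) = 2 * n / (n + 1) * bernoulli (2 * n) :=
    sum_weight_bottom_mul_bernoulli hn
  have hws : ∑ k ∈ Icc 1 n, w k = 2 * harmonic n
      - 2 / (2 * n + 1) * ∑ k ∈ Icc 1 n, 1 / ((2 * n).choose (2 * k - 1) : ℚ) :=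
    sum_weight_top (by omega)
  have hvs : ∑ k ∈ Icc 1 (n - 1), v k
      = 2 / (2 * n + 1) * ∑ k ∈ Icc 1 (n - 1), 1 / ((2 * n).choose (2 * k) : ℚ)
        - 4 * (harmonic (2 * n) - harmonic n - 1 / 2) := sum_weight_bottom (by omega)
  have hoe := sum_one_div_choose_odd_sub_even (n := n) (by omega)
  have hn0 : (n : ℚ) ≠ 0 := by positivity
  have hn1 : (n + 1 : ℚ) ≠ 0 := by positivity
  have hn2 : (2 * n + 1 : ℚ) ≠ 0 := by positivity
  have hwn : w n = (2 * n + 3) / (2 * n + 1) := by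
    simp only [w]
    rw [Nat.choose_symm_add, Nat.cast_choose_two]
    push_cast
    rw [show (n + 1 - n : ℚ) = 1 by ring, show (2 * n + 2 - 1 : ℚ) = 2 * n + 1 by ring]
    have : (2 * n + 2 : ℚ) ≠ 0 := by positivity
    field_simp
    ring
  -- The total coefficient of ζ(2n+2): Miki's value and ∑ w from the first sum, Matiyasevich's value
  -- and ∑ v from the second.
  have hharm : 1 / 4 * (2 / (n + 1) + 4 * harmonic (2 * n + 1)) - 1 / 2 * ∑ k ∈ Icc 1 n, w k
        - 1 / 2 * (n / (n + 1)) - 1 / 2 * ∑ k ∈ Icc 1 (n - 1), v k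
      = 3 * (harmonic (2 * n - 1) - harmonic (n - 1)
          - (2 * (n : ℚ) ^ 2 + n + 1) / (2 * n * (2 * n + 1))) := by
    have a1 : harmonic (2 * n) = harmonic (2 * n - 1) + 1 / (2 * n) := by
      conv_lhs => rw [show 2 * n = 2 * n - 1 + 1 by omega, harmonic_succ]
      rw [show 2 * n - 1 + 1 = 2 * n by omega]
      push_cast
      ring
    have a2 : harmonic n = harmonic (n - 1) + 1 / n := by
      conv_lhs => rw [show n = n - 1 + 1 by omega, harmonic_succ]
      rw [show n - 1 + 1 = n by omega, one_div]
    rw [hws, hvs, harmonic_succ, a1, a2, sub_eq_iff_eq_add.1 hoe]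
    push_cast
    field_simp
    ring
  have hz1 : riemannZeta (2 * n + 2) = zetaFactor (n + 1) * (bernoulli (2 * (n + 1)) : ℂ) := by
    rw [← riemannZeta_eq_zetaFactor_mul (by omega)]
    push_cast
    ring_nf
  have hz2 : riemannZeta (2 * n) = zetaFactor n * (bernoulli (2 * n) : ℂ) := by
    rw [← riemannZeta_eq_zetaFactor_mul (by omega)]
    push_cast
    rfl
  have hz0 : riemannZeta (2 * n) ≠ 0 := riemannZeta_ne_zero_of_one_lt_re (by
    have : (2 : ℝ) ≤ n := by exact_mod_cast hn
    simp
    linarith)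
  rw [hwB, riemannZeta_eq_zetaFactor_mul (by omega)] at hw
  rw [hvB, riemannZeta_eq_zetaFactor_mul (by omega), ← hz2] at hv
  -- Symmetry needs k up to n; the term k = n is the ζ(2n, 2) on the right-hand side.
  have hsplit : ∑ k ∈ Icc 1 n, (w k : ℂ) * doubleZeta (2 * k) (2 * (n + 1) - 2 * k)
      = ∑ k ∈ Icc 1 (n - 1), (w k : ℂ) * doubleZeta (2 * k) (2 * n + 2 - 2 * k)
        + (2 * n + 3) / (2 * n + 1) * doubleZeta (2 * n) 2 := by
    obtain ⟨p, rfl⟩ := Nat.exists_eq_add_of_le' (show 1 ≤ n by omega)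
    rw [sum_Icc_succ_top (by omega), hwn, Nat.add_sub_cancel,
      show 2 * (p + 1 + 1) - 2 * (p + 1) = 2 by omega]
    push_cast
    rfl
  have hgoal : ∀ k, (1 - 1 / ((2 * n + 2).choose (2 * k) : ℂ))
          * (((n : ℂ) + 1) / ((k : ℂ) * (n + 1 - k))) = (w k : ℂ)
      ∧ 2 / ((2 * (n : ℂ) + 1) * ((2 * n).choose (2 * k) : ℂ))
            - ((2 * (k : ℂ) - n) ^ 2 + (n + 1) * (n + 2))
              / (((n : ℂ) - k + 1) * (2 * n - 2 * k + 1) * (k + 1) * (2 * k + 1)) = (v k : ℂ) := by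
    intro k
    simp only [w, v]
    push_cast
    exact ⟨rfl, rfl⟩
  have hharm' := congrArg (Rat.cast : ℚ → ℂ) hharm
  -- The weight sums become opaque so that casts do not spread into them.
  generalize (∑ k ∈ Icc 1 n, w k : ℚ) = W at *
  generalize (∑ k ∈ Icc 1 (n - 1), v k : ℚ) = V at *
  push_cast at hharm' hw hv
  simp only [(hgoal _).1, (hgoal _).2]
  simp only [mul_assoc (riemannZeta _ / _)]
  rw [sum_add_distrib, ← mul_sum, hv, ← hharm', eq_sub_of_add_eq hsplit.symm, hw]
  have hr : riemannZeta (2 * n + 2) / riemannZeta (2 * n) * riemannZeta (2 * n)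
      = riemannZeta (2 * n + 2) := div_mul_cancel₀ _ hz0
  generalize riemannZeta (2 * n + 2) / riemannZeta (2 * n) = r at *
  rw [← hr, hz2] at hz1 ⊢
  linear_combination (-(1 / 4) * (2 / (n + 1 : ℂ) + 4 * (harmonic (2 * n + 1) : ℂ))
    + 1 / 2 * (W : ℂ)) * hz1
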